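/- Let $G$ be a compact Lie group with normalized Haar measure $dx$, and let $\mathcal L$ be the Laplace–Beltrami operator of a fixed bi-invariant Riemannian metric on $G$ (equivalently, the Casimir element $\sum_i X_i^2$, where $(X_i)$ is an orthonormal basis of the Lie algebra). For $\xi$ in the unitary dual $\widehat G$ let $d_\xi$ be its dimension, let $\lambda_\xi\ge 0$ be determined by $-\mathcal L\xi_{ij}=\lambda_\xi^2\xi_{ij}$, and let $\widehat f(\xi)=\int_G f(x)\xi(x)^*\,dx$. For $s>0$ put $(-\mathcal L)^{s/2}f=\sum_{[\xi]\in\widehat G}d_\xi\lambda_\xi^{s}\operatorname{Tr}(\xi(x)\widehat f(\xi))$, and let $H^s_{\mathcal L}(G)=\{f\in L^2(G):(-\mathcal L)^{s/2}f\in L^2(G)\}$ with norm $\|f\|_{L^2}+\|(-\mathcal L)^{s/2}f\|_{L^2}$. For $0<\alpha<1$, $p>1$, $\varepsilon>0$ and $(u_0,u_1)\in H^\alpha_{\mathcal L}(G)\times L^2(G)$ consider $$\partial_t^2u+(-\mathcal L)^\alpha u+\partial_tu=|u|^p,\qquad u(0,\cdot)=\varepsilon u_0,\quad \partial_tu(0,\cdot)=\varepsilon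 u_1. \tag{1}$$ For $0<T\le\infty$, an energy solution of (1) on $[0,T)$ is a (real- or complex-valued) function $$u\in \mathcal C([0,T),H^\alpha_{\mathcal L}(G))\cap \mathcal C^1([0,T),L^2(G))\cap L^p_{\rm loc}([0,T)\times G)$$ such that, for every $\phi\in \mathcal C_0^\infty([0,T)\times G)$ and every $t\in(0,T)$, $$\begin{aligned} &\int_G \partial_tu(t,x)\phi(t,x)\,dx-\int_G u(t,x)\,\partial_s\phi(t,x)\,dx+\int_G u(t,x)\phi(t,x)\,dx\\ &+\varepsilon\int_G u_0(x)\,\partial_s\phi(0,x)\,dx-\varepsilon\int_G u_1(x)\phi(0,x)\,dx-\varepsilon\int_G u_0(x)\phi(0,x)\,dx\\ &+\int_0^t\!\int_G u(s,x)\bigl(\partial_s^2\phi(s,x)+(-\mathcal L)^\alpha\phi(s,x)-\partial_s\phi(s,x)\bigr)\,dx\,ds=\int_0^t\!\int_G|u(s,x)|^p\phi(s,x)\,dx\,ds . \end{aligned}$$ The lifespan $T(\varepsilon)$ of an energy solution on $[0,T)$ is the supremum of all $T'\in[T,\infty]$ such that it extends to an energy solution on $[0,T')$; the solution blows up in finite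 time if $T(\varepsilon)<\infty$. **Theorem.** Let $p>1$, and let $u_0,u_1\in L^2(G)$ be (almost everywhere) nonnegative with $(u_0,u_1)\neq(0,0)$. Then there are constants $\varepsilon_0>0$ and $C>0$, depending only on $u_0,u_1,p$ (and on $G$ and its metric), such that for every $\alpha\in(0,1)$ with $u_0\in H^\alpha_{\mathcal L}(G)$ and every $\varepsilon\in(0,\varepsilon_0]$, every energy solution of (1) blows up in finite time, and its lifespan satisfies $$T(\varepsilon)\le C\varepsilon^{1-p}.$$ -/

import Mathlib

open MeasureTheory Set Filter Topology
open scoped Manifold ContDiff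

namespace FracDampedWave

noncomputable section

/-! ### The Laplace–Beltrami operator of a bi-invariant metric -/

section Laplacian

variable {n : ℕ} {G : Type*} [TopologicalSpace G] [ChartedSpace (EuclideanSpace ℝ (Fin n)) G]
  [Group G]

/-- The adjoint action `Ad x` on the Lie algebra: the derivative at `1` of `y ↦ x y x⁻¹`. -/
def adjoint (x : G) (v : GroupLieAlgebra (𝓡 n) G) : GroupLieAlgebra (𝓡 n) G :=
  (mfderiv (𝓡 n) (𝓡 n) (fun y : G => x * y * x⁻¹) 1 v : EuclideanSpace ℝ (Fin n))

variable (n G) in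
/-- A bi-invariant Riemannian metric on `G`, given by its value at the identity: an inner product
on the Lie algebra that is invariant under the adjoint action of the group. -/
structure BiinvariantMetric where
  form : LinearMap.BilinForm ℝ (GroupLieAlgebra (𝓡 n) G)
  symm : ∀ v w, form v w = form w v
  pos : ∀ v, v ≠ 0 → 0 < form v v
  adjoint_inv : ∀ (x : G) v w, form (adjoint x v) (adjoint x w) = form v w

/-- The `i`-th vector of the standard basis of the Lie algebra (a real vector space whose model
is `ℝⁿ`). -/
def stdBasis (i : Fin n) : GroupLieAlgebra (𝓡 n) G :=
  (EuclideanSpace.single i (1 : ℝ) : EuclideanSpace ℝ (Fin n))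

/-- The Gram matrix of the metric in the standard basis of the Lie algebra. -/
def BiinvariantMetric.gram (g : BiinvariantMetric n G) : Matrix (Fin n) (Fin n) ℝ :=
  Matrix.of fun i j => g.form (stdBasis i) (stdBasis j)

/-- The derivative of `f` along the left-invariant vector field of `v`. -/
def invariantDeriv (v : GroupLieAlgebra (𝓡 n) G) (f : G → ℂ) (x : G) : ℂ :=
  mfderiv (𝓡 n) 𝓘(ℝ, ℂ) f x (mulInvariantVectorField v x)

/-- The Laplace–Beltrami operator `𝓛` of the bi-invariant metric `g`, that is the Casimir element
`∑ i j, gⁱʲ Xᵢ Xⱼ` of `g` acting through left-invariant vector fields; here `(gⁱʲ)` is the inverse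
Gram matrix. (The value does not depend on the basis; it is `∑ i, Xᵢ²` for an orthonormal one.) -/
def laplacian (g : BiinvariantMetric n G) (f : G → ℂ) (x : G) : ℂ :=
  ∑ i, ∑ j, ((g.gram⁻¹ i j : ℝ) : ℂ) *
    invariantDeriv (stdBasis i) (invariantDeriv (stdBasis j) f) x

end Laplacian

/-! ### Unitary dual and Fourier transform -/

/-- A continuous irreducible unitary representation of `G` on `ℂᵈ`, `d ≥ 1`. -/
structure UnitaryIrrep (G : Type*) [TopologicalSpace G] [Group G] where
  dim : ℕ
  dim_pos : 0 < dim
  rep : G →* Matrix.unitaryGroup (Fin dim) ℂ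
  continuous_rep : Continuous rep
  irreducible : ∀ W : Submodule ℂ (Fin dim → ℂ),
    (∀ x : G, ∀ v ∈ W, (rep x : Matrix (Fin dim) (Fin dim) ℂ).mulVec v ∈ W) → W = ⊥ ∨ W = ⊤

section Fourier

variable {G : Type*} [TopologicalSpace G] [Group G]

/-- The representation as a matrix-valued function. -/
def UnitaryIrrep.mat (ξ : UnitaryIrrep G) (x : G) : Matrix (Fin ξ.dim) (Fin ξ.dim) ℂ :=
  (ξ.rep x : Matrix (Fin ξ.dim) (Fin ξ.dim) ℂ)

theorem UnitaryIrrep.continuous_mat (ξ : UnitaryIrrep G) : Continuous ξ.mat :=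
  continuous_subtype_val.comp ξ.continuous_rep

variable (G) in
/-- Unitary equivalence: there is a unitary intertwiner `U`. -/
instance unitarySetoid : Setoid (UnitaryIrrep G) where
  r ξ η := ∃ U : Matrix (Fin ξ.dim) (Fin η.dim) ℂ,
    U * U.conjTranspose = 1 ∧ U.conjTranspose * U = 1 ∧ ∀ x, ξ.mat x * U = U * η.mat x
  iseqv := by
    refine ⟨fun ξ => ⟨1, by simp⟩, ?_, ?_⟩
    · rintro ξ η ⟨U, h1, h2, h⟩
      refine ⟨U.conjTranspose, by simpa using h2, by simpa using h1, fun x => ?_⟩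
      calc η.mat x * U.conjTranspose
          = U.conjTranspose * (U * η.mat x) * U.conjTranspose := by
            rw [← Matrix.mul_assoc, h2, Matrix.one_mul]
        _ = U.conjTranspose * ξ.mat x := by
            rw [← h x, Matrix.mul_assoc, Matrix.mul_assoc, h1, Matrix.mul_one]
    · rintro ξ η ζ ⟨U, h1, h2, h⟩ ⟨V, k1, k2, k⟩
      refine ⟨U * V, ?_, ?_, fun x => ?_⟩
      · rw [Matrix.conjTranspose_mul, Matrix.mul_assoc, ← Matrix.mul_assoc V, k1,
          Matrix.one_mul, h1]
      · rw [Matrix.conjTranspose_mul, Matrix.mul_assoc, ← Matrix.mul_assoc _ U, h2,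
          Matrix.one_mul, k2]
      · rw [← Matrix.mul_assoc, h x, Matrix.mul_assoc, k x, Matrix.mul_assoc]

variable (G) in
/-- The unitary dual: equivalence classes of continuous irreducible unitary representations. -/
def UnitaryDual : Type _ := Quotient (unitarySetoid G)

/-- A representative of a class. None of the quantities below depends on its choice. -/
def UnitaryDual.irrep (c : UnitaryDual G) : UnitaryIrrep G := Quotient.out c

/-- The matrix coefficient `ξᵢⱼ`. -/
def UnitaryIrrep.coeff (ξ : UnitaryIrrep G) (i j : Fin ξ.dim) (x : G) : ℂ := ξ.mat x i j

/-- The Fourier coefficient `f̂(ξ) = ∫ f(x) ξ(x)* dx`, entry by entry. -/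
def groupFourier [MeasurableSpace G] (μ : Measure G) (f : G → ℂ) (ξ : UnitaryIrrep G) :
    Matrix (Fin ξ.dim) (Fin ξ.dim) ℂ :=
  Matrix.of fun i j => ∫ x, f x * (ξ.mat x).conjTranspose i j ∂μ

/-- The squared Hilbert–Schmidt norm. -/
def hsNormSq {d : ℕ} (A : Matrix (Fin d) (Fin d) ℂ) : ℝ := ∑ i, ∑ j, ‖A i j‖ ^ 2

/-- The continuous function `x ↦ d_ξ Tr (ξ(x) A)`. -/
def fourierTerm (ξ : UnitaryIrrep G) (A : Matrix (Fin ξ.dim) (Fin ξ.dim) ℂ) : C(G, ℂ) where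
  toFun x := (ξ.dim : ℂ) * (ξ.mat x * A).trace
  continuous_toFun :=
    continuous_const.mul ((ξ.continuous_mat.matrix_mul continuous_const).matrix_trace)

end Fourier

/-! ### Fractional powers of `-𝓛` and Sobolev spaces -/

section Fractional

variable {n : ℕ} {G : Type*} [TopologicalSpace G] [ChartedSpace (EuclideanSpace ℝ (Fin n)) G]
  [Group G]

open Classical in
/-- The number `λ_ξ ≥ 0` with `-𝓛 ξᵢⱼ = λ_ξ² ξᵢⱼ` for all `i`, `j`. It exists and is unique on a
compact Lie group. -/
def eigenvalueRoot (g : BiinvariantMetric n G) (ξ : UnitaryIrrep G) : ℝ :=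
  if h : ∃ l : ℝ, 0 ≤ l ∧ ∀ i j x,
      -laplacian g (ξ.coeff i j) x = ((l ^ 2 : ℝ) : ℂ) * ξ.coeff i j x
  then h.choose else 0

variable [MeasurableSpace G] [BorelSpace G] [CompactSpace G]

/-- The operator `(-𝓛)^(s/2) f = F⁻¹ (λ_ξ^s F f)`; the inverse Fourier transform is the series
`∑ d_ξ Tr (ξ(x) ·)` over the unitary dual, summed in `L²(G)`. -/
def laplacianHalfPow (g : BiinvariantMetric n G) (μ : Measure G) [IsFiniteMeasure μ]
    (s : ℝ) (f : G → ℂ) : Lp ℂ 2 μ :=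
  ∑' c : UnitaryDual G, ContinuousMap.toLp 2 μ ℂ
    (fourierTerm c.irrep (((eigenvalueRoot g c.irrep ^ s : ℝ) : ℂ) • groupFourier μ f c.irrep))

/-- Membership in `H^s_𝓛(G)`: the square of `‖(-𝓛)^(s/2) f‖`, which is
`∑ d_ξ λ_ξ^(2s) ‖f̂(ξ)‖²_HS`, is finite. -/
def MemSobolev (g : BiinvariantMetric n G) (μ : Measure G) (s : ℝ) (f : Lp ℂ 2 μ) : Prop :=
  Summable fun c : UnitaryDual G =>
    (c.irrep.dim : ℝ) * eigenvalueRoot g c.irrep ^ (2 * s) * hsNormSq (groupFourier μ f c.irrep)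

/-- The norm `‖f‖ + ‖(-𝓛)^(s/2) f‖` of `H^s_𝓛(G)`. -/
def sobolevNorm (g : BiinvariantMetric n G) (μ : Measure G) [IsFiniteMeasure μ]
    (s : ℝ) (f : Lp ℂ 2 μ) : ℝ :=
  ‖f‖ + ‖laplacianHalfPow g μ s f‖

/-! ### Energy solutions -/

/-- The time interval `[0, T)`, for `T ≤ ∞`. -/
def timeInterval (T : EReal) : Set ℝ := {t : ℝ | 0 ≤ t ∧ (t : EReal) < T}

variable (n) in
/-- Test functions in `C₀^∞([0, T) × G)`: restrictions to `[0, T) × G` of smooth functions on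
`ℝ × G` with compact support in `(-∞, T) × G`. -/
structure IsTestFunction (T : EReal) (φ : ℝ × G → ℂ) : Prop where
  smooth : ContMDiff (𝓘(ℝ, ℝ).prod (𝓡 n)) 𝓘(ℝ, ℂ) ∞ φ
  compactSupport : HasCompactSupport φ
  support : tsupport φ ⊆ {z | (z.1 : EReal) < T}

/-- The time derivative `∂ₛ φ`. -/
def timeDeriv (φ : ℝ × G → ℂ) (z : ℝ × G) : ℂ := deriv (fun r => φ (r, z.2)) z.1

/-- `u` is an energy solution on `[0, T)`, `0 < T ≤ ∞`, of
`∂ₜ² u + (-𝓛)^α u + ∂ₜ u = |u|ᵖ`, `u(0) = ε u₀`, `∂ₜ u(0) = ε u₁`. -/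
structure IsEnergySolution (g : BiinvariantMetric n G) (μ : Measure G) [IsFiniteMeasure μ]
    (α p ε : ℝ) (u₀ u₁ : Lp ℂ 2 μ) (T : EReal) (u : ℝ → Lp ℂ 2 μ) : Prop where
  pos : 0 < T
  /-- `u ∈ C([0, T), H^α_𝓛(G))` -/
  memSobolev : ∀ t ∈ timeInterval T, MemSobolev g μ α (u t)
  continuous_sobolev : ∀ t ∈ timeInterval T,
    Tendsto (fun s => sobolevNorm g μ α (u s - u t)) (𝓝[timeInterval T] t) (𝓝 0)
  /-- `u ∈ C¹([0, T), L²(G))` -/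
  contDiffOn : ContDiffOn ℝ 1 u (timeInterval T)
  /-- `u ∈ Lᵖ_loc([0, T) × G)`, for a function `w` on `[0, T) × G` that represents `u` -/
  memLp_loc : ∃ w : ℝ × G → ℂ,
    (∀ᵐ s ∂(volume.restrict (timeInterval T)), ∀ᵐ x ∂μ, u s x = w (s, x)) ∧
    ∀ t ∈ timeInterval T, MemLp w (ENNReal.ofReal p) ((volume.restrict (Icc 0 t)).prod μ)
  integral_eq : ∀ φ : ℝ × G → ℂ, IsTestFunction n T φ → ∀ t ∈ timeInterval T, 0 < t →
    (∫ x, derivWithin u (timeInterval T) t x * φ (t, x) ∂μ)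
      - (∫ x, u t x * timeDeriv φ (t, x) ∂μ)
      + (∫ x, u t x * φ (t, x) ∂μ)
      + (ε : ℂ) * (∫ x, u₀ x * timeDeriv φ (0, x) ∂μ)
      - (ε : ℂ) * (∫ x, u₁ x * φ (0, x) ∂μ)
      - (ε : ℂ) * (∫ x, u₀ x * φ (0, x) ∂μ)
      + (∫ s in (0 : ℝ)..t, ∫ x, u s x *
          (timeDeriv (timeDeriv φ) (s, x)
            + laplacianHalfPow g μ (2 * α) (fun y => φ (s, y)) x
            - timeDeriv φ (s, x)) ∂μ)
      = ∫ s in (0 : ℝ)..t, ∫ x, ((‖u s x‖ ^ p : ℝ) : ℂ) * φ (s, x) ∂μ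

/-- The lifespan of an energy solution `u` on `[0, T)`: the supremum of all `T' ≥ T` such that `u`
extends to an energy solution on `[0, T')`. The solution blows up in finite time if its lifespan
is finite. -/
def lifespan (g : BiinvariantMetric n G) (μ : Measure G) [IsFiniteMeasure μ]
    (α p ε : ℝ) (u₀ u₁ : Lp ℂ 2 μ) (T : EReal) (u : ℝ → Lp ℂ 2 μ) : EReal :=
  sSup {T' : EReal | T ≤ T' ∧ ∃ v : ℝ → Lp ℂ 2 μ,
    IsEnergySolution g μ α p ε u₀ u₁ T' v ∧ ∀ t ∈ timeInterval T, v t = u t}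

end Fractional

end

end FracDampedWave

namespace FracDampedWave

/-! This is the test function method with test functions η of time alone, admissible because `G` is
compact. The operator `(-𝓛)^α` annihilates constants, so it drops out and α plays no role. With F
the mean of `u` over `G`, N the mean of |u|^p and J the integral of Re u₀ + Re u₁, testing up to a
time R < T gives εJ + ∫ N η = ∫ Re F (η'' - η'). If η lives at scale R ≥ 1 with |η'' - η'| ≤ (K/R)
η^(1/p), Young's inequality bounds the right side by ∫ |F|^p η + R (K/R)^q, and Jensen's |F|^p ≤ N
lets the first term be absorbed. Hence εJ ≤ K^q R^(1-q) for every such R < T. Since 1 - q = -1/(p-1)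
and J > 0, this bounds T by a multiple of ε^(1-p). -/

/-! ### Cutoff functions in time -/

theorem exists_profile {p : ℝ} (hp : 1 < p) :
    ∃ K : ℝ, 0 < K ∧ ∃ ψ : ℝ → ℝ, ContDiff ℝ ∞ ψ ∧ (∀ s, 0 ≤ ψ s) ∧
      tsupport ψ ⊆ Icc (-1) 1 ∧ ψ 1 = 0 ∧ deriv ψ 1 = 0 ∧ ψ 0 = 1 ∧ deriv ψ 0 = 0 ∧
      (∀ s, |deriv ψ s| ≤ K * ψ s ^ (1 / p)) ∧
      (∀ s, |deriv (deriv ψ) s| ≤ K * ψ s ^ (1 / p)) := by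
  let χ : ContDiffBump (0 : ℝ) := ⟨1 / 2, 1, by norm_num, by norm_num⟩
  have hχ : ContDiff ℝ ∞ χ := χ.contDiff
  have hχ' : ContDiff ℝ ∞ (deriv χ) := ((contDiff_infty_iff_deriv).1 hχ).2
  have hχ'' : ContDiff ℝ ∞ (deriv (deriv χ)) := ((contDiff_infty_iff_deriv).1 hχ').2
  have hc : HasCompactSupport χ := χ.hasCompactSupport
  obtain ⟨A, hA⟩ := hc.deriv.exists_bound_of_continuous hχ'.continuous
  obtain ⟨B, hB⟩ := hc.deriv.deriv.exists_bound_of_continuous hχ''.continuous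
  have hA0 : 0 ≤ A := (norm_nonneg _).trans (hA 0)
  have hB0 : 0 ≤ B := (norm_nonneg _).trans (hB 0)
  -- The profile is χ^(m+2). Its first two derivatives keep a factor χ^m, and m ≤ χ's exponent
  -- budget: (m+2)/p ≤ m holds exactly when m ≥ 2/(p-1), so χ^m is dominated by the p-th root of the
  -- profile.
  obtain ⟨m, hm⟩ := exists_nat_ge (2 / (p - 1))
  have hpow : ∀ s, χ s ^ m ≤ (χ s ^ (m + 2)) ^ (1 / p) := fun s ↦ by
    rw [← Real.rpow_natCast, ← Real.rpow_natCast, ← Real.rpow_mul χ.nonneg]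
    refine Real.rpow_le_rpow_of_exponent_ge' χ.nonneg χ.le_one (by positivity) ?_
    rw [div_le_iff₀ (by linarith)] at hm
    rw [mul_one_div, div_le_iff₀ (by linarith)]
    push_cast
    nlinarith
  have h1 : ∀ s, HasDerivAt (fun s ↦ χ s ^ (m + 2)) ((m + 2) * χ s ^ (m + 1) * deriv χ s) s :=
    fun s ↦ by
      simpa using ((hχ.differentiable (by simp)) s).hasDerivAt.fun_pow (m + 2)
  have e1 : deriv (fun s ↦ χ s ^ (m + 2)) = fun s ↦ (m + 2) * χ s ^ (m + 1) * deriv χ s :=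
    funext fun s ↦ (h1 s).deriv
  have h2 : ∀ s, HasDerivAt (fun s ↦ (m + 2 : ℝ) * χ s ^ (m + 1) * deriv χ s)
      ((m + 2) * ((m + 1) * χ s ^ m * deriv χ s) * deriv χ s
        + (m + 2) * χ s ^ (m + 1) * deriv (deriv χ) s) s := fun s ↦ by
    have := ((((hχ.differentiable (by simp)) s).hasDerivAt.fun_pow (m + 1)).const_mul
      (m + 2 : ℝ)).fun_mul ((hχ'.differentiable (by simp)) s).hasDerivAt
    simpa using this
  have z1 : χ 1 = 0 := χ.zero_of_le_dist (by simp [χ])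
  have o0 : χ 0 = 1 := χ.one_of_mem_closedBall (by simp [χ])
  have d0 : deriv χ 0 = 0 := by
    have : (χ : ℝ → ℝ) =ᶠ[𝓝 0] 1 := χ.eventuallyEq_one
    rw [this.deriv_eq]
    simp [Pi.one_def]
  have hle : ∀ s, χ s ^ (m + 1) ≤ χ s ^ m := fun s ↦
    pow_le_pow_of_le_one χ.nonneg χ.le_one (by omega)
  have hn : ∀ s, 0 ≤ χ s ^ m := fun s ↦ pow_nonneg χ.nonneg _
  refine ⟨(m + 2) * (m + 1) * A ^ 2 + (m + 2) * A + (m + 2) * B + 1, by positivity,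
    fun s ↦ χ s ^ (m + 2), hχ.pow _, fun s ↦ pow_nonneg χ.nonneg _, ?_, by simp [z1],
    by simp [e1, z1], by simp [o0], by simp [e1, d0], fun s ↦ ?_, fun s ↦ ?_⟩
  · have : tsupport χ = Icc (-1) 1 := by
      rw [χ.tsupport_eq, Real.closedBall_eq_Icc]; simp [χ]
    rw [← this]
    refine closure_mono fun s hs ↦ ?_
    simp only [Function.mem_support] at hs ⊢
    exact fun h ↦ hs (by simp [h])
  · rw [e1]
    calc |(m + 2) * χ s ^ (m + 1) * deriv χ s|
        = (m + 2) * χ s ^ (m + 1) * ‖deriv χ s‖ := by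
          rw [abs_mul, abs_of_nonneg (by have := χ.nonneg (x := s); positivity)]; rfl
      _ ≤ (m + 2) * χ s ^ m * A :=
          mul_le_mul (mul_le_mul_of_nonneg_left (hle s) (by positivity)) (hA s) (norm_nonneg _)
            (mul_nonneg (by positivity) (hn s))
      _ = ((m + 2) * A) * χ s ^ m := by ring
      _ ≤ _ := by
          refine mul_le_mul ?_ (hpow s) (hn s) (by positivity)
          have : 0 ≤ (m + 2) * (m + 1) * A ^ 2 := by positivity
          have : 0 ≤ (m + 2) * B := by positivity
          linarith
  · rw [e1, (h2 s).deriv]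
    calc |(m + 2) * ((m + 1) * χ s ^ m * deriv χ s) * deriv χ s
        + (m + 2) * χ s ^ (m + 1) * deriv (deriv χ) s|
        ≤ (m + 2) * (m + 1) * χ s ^ m * ‖deriv χ s‖ ^ 2
          + (m + 2) * χ s ^ (m + 1) * ‖deriv (deriv χ) s‖ := by
          refine (abs_add_le _ _).trans (le_of_eq ?_)
          have := χ.nonneg (x := s)
          simp only [abs_mul, Real.norm_eq_abs, abs_pow, abs_of_nonneg this,
            abs_of_nonneg (show (0 : ℝ) ≤ m + 2 by positivity),
            abs_of_nonneg (show (0 : ℝ) ≤ m + 1 by positivity)]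
          ring
      _ ≤ (m + 2) * (m + 1) * χ s ^ m * A ^ 2 + (m + 2) * χ s ^ m * B := by
          refine add_le_add (mul_le_mul_of_nonneg_left ?_ (mul_nonneg (by positivity) (hn s)))
            (mul_le_mul (mul_le_mul_of_nonneg_left (hle s) (by positivity)) (hB s)
              (norm_nonneg _) (mul_nonneg (by positivity) (hn s)))
          exact pow_le_pow_left₀ (norm_nonneg _) (hA s) 2
      _ = ((m + 2) * (m + 1) * A ^ 2 + (m + 2) * B) * χ s ^ m := by ring
      _ ≤ _ := by
          refine mul_le_mul ?_ (hpow s) (hn s) (by positivity)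
          have : 0 ≤ (m + 2) * A := by positivity
          linarith

/-- Smooth cutoffs at scale `R`, with the derivative bounds required by the test function
method. -/
theorem exists_cutoff {p : ℝ} (hp : 1 < p) :
    ∃ K : ℝ, 0 < K ∧ ∀ R : ℝ, 1 ≤ R → ∃ η : ℝ → ℝ, ContDiff ℝ ∞ η ∧ (∀ s, 0 ≤ η s) ∧
      tsupport η ⊆ Icc (-R) R ∧ η R = 0 ∧ deriv η R = 0 ∧ η 0 = 1 ∧ deriv η 0 = 0 ∧
      ∀ s, |deriv (deriv η) s - deriv η s| ≤ K / R * η s ^ (1 / p) := by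
  obtain ⟨K, hK, ψ, hψ, h0, hs, hR, hR', ho, ho', hd, hdd⟩ := exists_profile hp
  refine ⟨2 * K, by positivity, fun R hR1 ↦ ?_⟩
  have hRpos : 0 < R := by linarith
  have e1 : deriv (fun s ↦ ψ (R⁻¹ * s)) = fun s ↦ R⁻¹ * deriv ψ (R⁻¹ * s) := by
    ext s; simpa using deriv_comp_mul_left R⁻¹ ψ s
  have e2 : deriv (deriv (fun s ↦ ψ (R⁻¹ * s))) =
      fun s ↦ R⁻¹ * (R⁻¹ * deriv (deriv ψ) (R⁻¹ * s)) := by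
    ext s
    rw [e1, deriv_const_mul_field]
    congr 1
    simpa using deriv_comp_mul_left R⁻¹ (deriv ψ) s
  refine ⟨fun s ↦ ψ (R⁻¹ * s), hψ.comp (contDiff_const.mul contDiff_id), fun s ↦ h0 _, ?_,
    by simp [hRpos.ne', hR], by simp [e1, hRpos.ne', hR'], by simp [ho], by simp [e1, ho'],
    fun s ↦ ?_⟩
  · refine closure_minimal (fun s hs' ↦ ?_) isClosed_Icc
    have := hs (subset_tsupport _ (show R⁻¹ * s ∈ Function.support ψ from hs'))
    rw [inv_mul_eq_div, mem_Icc, le_div_iff₀ hRpos, div_le_iff₀ hRpos] at this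
    constructor <;> linarith [this.1, this.2]
  · rw [e2, e1]
    -- The second derivative scales like R⁻²; R ≥ 1 lets it be absorbed into the R⁻¹ of the damping
    -- term.
    have hinv : R⁻¹ ≤ 1 := inv_le_one_of_one_le₀ hR1
    have hinv0 : 0 ≤ R⁻¹ := by positivity
    have hX : 0 ≤ K * ψ (R⁻¹ * s) ^ (1 / p) := mul_nonneg hK.le (Real.rpow_nonneg (h0 _) _)
    calc |R⁻¹ * (R⁻¹ * deriv (deriv ψ) (R⁻¹ * s)) - R⁻¹ * deriv ψ (R⁻¹ * s)|
        ≤ R⁻¹ * (R⁻¹ * |deriv (deriv ψ) (R⁻¹ * s)|) + R⁻¹ * |deriv ψ (R⁻¹ * s)| := by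
          refine (abs_sub _ _).trans (le_of_eq ?_)
          simp only [abs_mul, abs_of_nonneg hinv0]
      _ ≤ R⁻¹ * (1 * (K * ψ (R⁻¹ * s) ^ (1 / p))) + R⁻¹ * (K * ψ (R⁻¹ * s) ^ (1 / p)) := by
          gcongr
          · exact hdd _
          · exact hd _
      _ = _ := by field_simp; ring

/-! ### The fractional Laplacian annihilates constants -/

section Constants

variable {n : ℕ} {G : Type*} [TopologicalSpace G] [ChartedSpace (EuclideanSpace ℝ (Fin n)) G]
  [Group G]

/-- A diagonal coefficient is the constant 1, which the Laplacian kills, so any admissible l has l²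
= 0; otherwise the default value is already 0. -/
theorem eigenvalueRoot_eq_zero_of_rep_eq_one (g : BiinvariantMetric n G) (ξ : UnitaryIrrep G)
    (h : ∀ x, ξ.mat x = 1) : eigenvalueRoot g ξ = 0 := by
  unfold eigenvalueRoot
  split_ifs with hl
  · have hs := hl.choose_spec
    generalize hl.choose = l at hs ⊢
    have hc : ξ.coeff ⟨0, ξ.dim_pos⟩ ⟨0, ξ.dim_pos⟩ = fun _ ↦ (1 : ℂ) := by
      ext x; simp [UnitaryIrrep.coeff, h]
    have hd : ∀ v : GroupLieAlgebra (𝓡 n) G,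
        ∀ c : ℂ, invariantDeriv v (fun _ : G ↦ c) = fun _ ↦ 0 := by
      intro v c; ext x; simp [invariantDeriv, mfderiv_const]; rfl
    have := hs.2 ⟨0, ξ.dim_pos⟩ ⟨0, ξ.dim_pos⟩ 1
    rw [hc] at this
    simp only [laplacian, hd] at this
    simpa using this.symm
  · rfl

variable [CompactSpace G] [MeasurableSpace G] [BorelSpace G]
  (μ : Measure G) [μ.IsHaarMeasure]

theorem integrable_coeff (ξ : UnitaryIrrep G) (i j : Fin ξ.dim) :
    Integrable (fun x ↦ ξ.mat x i j) μ :=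
  ((ξ.continuous_mat.matrix_elem i j)).integrable_of_hasCompactSupport
    (HasCompactSupport.of_compactSpace _)

variable [IsTopologicalGroup G]

/-- A matrix coefficient of an irreducible representation either has mean zero or belongs to the
trivial representation. -/
theorem integral_coeff_eq_zero_or_rep_eq_one (ξ : UnitaryIrrep G) :
    (∀ i j, ∫ x, ξ.mat x i j ∂μ = 0) ∨ ∀ x, ξ.mat x = 1 := by
  have hmul : ∀ x y, ξ.mat (x * y) = ξ.mat x * ξ.mat y := fun x y ↦ by
    simp [UnitaryIrrep.mat, map_mul]
  -- The fixed vectors form an invariant subspace, so irreducibility makes it trivial or everything.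
  let W : Submodule ℂ (Fin ξ.dim → ℂ) :=
    { carrier := {v | ∀ x, (ξ.mat x).mulVec v = v}
      add_mem' := fun ha hb x ↦ by rw [Matrix.mulVec_add, ha x, hb x]
      zero_mem' := fun x ↦ Matrix.mulVec_zero _
      smul_mem' := fun c v hv x ↦ by rw [Matrix.mulVec_smul, hv x] }
  rcases ξ.irreducible W (fun x v hv ↦ by
    have : (ξ.rep x : Matrix _ _ ℂ).mulVec v = v := hv x
    rwa [this]) with hW | hW
  · left
    intro i j
    -- By left invariance of Haar measure, each column of the averaged matrix is a fixed vector.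
    have hmem : (fun k ↦ ∫ x, ξ.mat x k j ∂μ) ∈ W := by
      intro y
      ext k
      simp only [Matrix.mulVec, dotProduct]
      simp_rw [← integral_const_mul]
      rw [← integral_finsetSum _ fun l _ ↦ (integrable_coeff μ ξ l j).const_mul _,
        ← integral_mul_left_eq_self (fun x ↦ ξ.mat x k j) y]
      simp_rw [hmul, Matrix.mul_apply]
    rw [hW, Submodule.mem_bot] at hmem
    exact congrFun hmem i
  · right
    intro x
    refine Matrix.ext_of_mulVec_single fun j ↦ ?_
    have : Pi.single j (1 : ℂ) ∈ W := hW ▸ Submodule.mem_top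
    rw [this x, Matrix.one_mulVec]

variable [IsFiniteMeasure μ]

/-- Every term of the series vanishes: the Fourier coefficient is zero off the trivial
representation, and there the multiplier is 0^s = 0, which needs s ≠ 0. -/
theorem laplacianHalfPow_const (g : BiinvariantMetric n G) {s : ℝ} (hs : s ≠ 0) (c : ℂ) :
    laplacianHalfPow g μ s (fun _ ↦ c) = 0 := by
  unfold laplacianHalfPow
  have key : ∀ ξ : UnitaryIrrep G,
      ((eigenvalueRoot g ξ ^ s : ℝ) : ℂ) • groupFourier μ (fun _ ↦ c) ξ = 0 := by
    intro ξ
    rcases integral_coeff_eq_zero_or_rep_eq_one μ ξ with h | h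
    · have : groupFourier μ (fun _ ↦ c) ξ = 0 := by
        ext i j
        simp only [groupFourier, Matrix.of_apply, Matrix.conjTranspose_apply, Matrix.zero_apply]
        rw [integral_const_mul]
        have := integral_conj (μ := μ) (f := fun x ↦ ξ.mat x j i)
        rw [h j i, map_zero] at this
        exact mul_eq_zero_of_right _ this
      rw [this, smul_zero]
    · rw [eigenvalueRoot_eq_zero_of_rep_eq_one g ξ h, Real.zero_rpow hs]
      simp
  have hz : ∀ ξ : UnitaryIrrep G, fourierTerm ξ 0 = 0 := fun ξ ↦ by
    ext x; simp [fourierTerm]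
  simp_rw [key, hz, map_zero, tsum_zero]

end Constants


/-! ### Means over the group -/

section Mean

variable {G : Type*} [MeasurableSpace G] {μ : Measure G}

/-- Jensen's inequality for t ↦ t^p; total mass 1 makes the constant 1. -/
theorem norm_integral_rpow_le [IsProbabilityMeasure μ] {p : ℝ} (hp : 1 ≤ p) {f : G → ℂ}
    (hf : Integrable f μ) (hfp : Integrable (fun x ↦ ‖f x‖ ^ p) μ) :
    ‖∫ x, f x ∂μ‖ ^ p ≤ ∫ x, ‖f x‖ ^ p ∂μ := by
  have h := (convexOn_rpow hp).map_integral_le (μ := μ) (f := fun x ↦ ‖f x‖)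
    (Real.continuous_rpow_const (by linarith)).continuousOn isClosed_Ici
    (ae_of_all _ fun x ↦ norm_nonneg _) hf.norm hfp
  exact (Real.rpow_le_rpow (norm_nonneg _) (norm_integral_le_integral_norm _)
    (by linarith)).trans h

theorem continuous_integral_L2 [IsFiniteMeasure μ] :
    Continuous fun f : Lp ℂ 2 μ ↦ ∫ x, f x ∂μ := by
  have : (fun f : Lp ℂ 2 μ ↦ ∫ x, f x ∂μ) = fun f ↦
      -- The mean is the `L²` pairing with the constant 1.
      inner ℂ (indicatorConstLp 2 MeasurableSet.univ (measure_ne_top μ univ) (1 : ℂ)) f := by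
    ext f
    rw [L2.inner_indicatorConstLp_one, setIntegral_univ]
  rw [this]
  fun_prop

theorem integrable_of_L2 [IsFiniteMeasure μ] (f : Lp ℂ 2 μ) : Integrable f μ :=
  (Lp.memLp f).integrable (by norm_num)

theorem integral_re_pos_of_ne_zero [IsFiniteMeasure μ] {f : Lp ℂ 2 μ}
    (hf : ∀ᵐ x ∂μ, (f x).im = 0 ∧ 0 ≤ (f x).re) (h0 : f ≠ 0) : 0 < (∫ x, f x ∂μ).re := by
  have hre : (∫ x, f x ∂μ).re = ∫ x, (f x).re ∂μ :=
    (integral_re (integrable_of_L2 f)).symm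
  rw [hre]
  have hnn : 0 ≤ᵐ[μ] fun x ↦ (f x).re := hf.mono fun x hx ↦ hx.2
  refine (integral_nonneg_of_ae hnn).lt_of_ne fun h ↦ h0 ?_
  have hz := (integral_eq_zero_iff_of_nonneg_ae hnn (integrable_of_L2 f).re).1 h.symm
  refine (Lp.eq_zero_iff_ae_eq_zero).2 ?_
  filter_upwards [hf, hz] with x hx hx'
  exact Complex.ext hx' hx.1

end Mean

/-! ### Testing the equation against functions of time -/

section Energy

variable {n : ℕ} {G : Type*}

theorem timeDeriv_time {η : ℝ → ℝ} (hη : Differentiable ℝ η) :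
    timeDeriv (fun z : ℝ × G ↦ (η z.1 : ℂ)) = fun z ↦ ((deriv η z.1 : ℝ) : ℂ) := by
  ext z
  exact ((hη z.1).hasDerivAt.ofReal_comp).deriv

variable [TopologicalSpace G] [ChartedSpace (EuclideanSpace ℝ (Fin n)) G] [CompactSpace G]
  {T : EReal}

theorem isTestFunction_time {η : ℝ → ℝ} (hη : ContDiff ℝ ∞ η) {R : ℝ}
    (hs : tsupport η ⊆ Icc (-R) R) (hT : (R : EReal) < T) :
    IsTestFunction n T fun z : ℝ × G ↦ (η z.1 : ℂ) := by
  have hsub : tsupport (fun z : ℝ × G ↦ (η z.1 : ℂ)) ⊆ Icc (-R) R ×ˢ univ := by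
    refine closure_minimal (fun z hz ↦ ⟨hs (subset_tsupport _ ?_), trivial⟩)
      (isClosed_Icc.prod isClosed_univ)
    simpa using hz
  refine ⟨?_, ?_, fun z hz ↦ ?_⟩
  · have h1 : ContMDiff 𝓘(ℝ, ℝ) 𝓘(ℝ, ℂ) ∞ (fun s : ℝ ↦ (η s : ℂ)) :=
      (Complex.ofRealCLM.contDiff.comp hη).contMDiff
    exact h1.comp contMDiff_fst
  · exact (isCompact_Icc.prod isCompact_univ).of_isClosed_subset (isClosed_tsupport _) hsub
  · exact lt_of_le_of_lt (EReal.coe_le_coe_iff.2 (hsub hz).1.2) hT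

variable [Group G] [MeasurableSpace G] [BorelSpace G]
  {g : BiinvariantMetric n G} {μ : Measure G} {α p ε : ℝ} {u₀ u₁ : Lp ℂ 2 μ}
  {u : ℝ → Lp ℂ 2 μ}

section Power

variable [IsFiniteMeasure μ]

/-- Fubini for the representative `w`. This makes Jensen applicable at almost every time and the
nonlinear term genuinely integrable. -/
theorem IsEnergySolution.integrableOn_power (h : IsEnergySolution g μ α p ε u₀ u₁ T u)
    (hp : 1 < p) {R : ℝ} (hR : R ∈ timeInterval T) :
    (∀ᵐ s ∂volume.restrict (Icc 0 R), Integrable (fun x ↦ ‖u s x‖ ^ p) μ) ∧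
      IntegrableOn (fun s ↦ ∫ x, ‖u s x‖ ^ p ∂μ) (Icc 0 R) := by
  obtain ⟨w, hw, hm⟩ := h.memLp_loc
  have hI : Integrable (fun z : ℝ × G ↦ ‖w z‖ ^ p) ((volume.restrict (Icc 0 R)).prod μ) := by
    have := (hm R hR).integrable_norm_rpow (by simp; linarith) (by simp)
    rwa [ENNReal.toReal_ofReal (by linarith)] at this
  have hw' : ∀ᵐ s ∂volume.restrict (Icc 0 R), ∀ᵐ x ∂μ, u s x = w (s, x) := by
    refine ae_restrict_of_ae_restrict_of_subset (fun s hs ↦ ?_) hw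
    exact ⟨hs.1, (EReal.coe_le_coe_iff.2 hs.2).trans_lt hR.2⟩
  constructor
  · filter_upwards [hw', hI.prod_right_ae] with s hs hsI
    exact hsI.congr (hs.mono fun x hx ↦ by simp only [hx])
  · refine hI.integral_prod_left.congr ?_
    filter_upwards [hw'] with s hs
    exact integral_congr_ae (hs.mono fun x hx ↦ by simp only [hx])

end Power

variable [IsTopologicalGroup G] [μ.IsHaarMeasure] [IsProbabilityMeasure μ]

/-- The equation tested against a function of time alone. -/
theorem IsEnergySolution.mean_eq (h : IsEnergySolution g μ α p ε u₀ u₁ T u) (hα : 0 < α)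
    {η : ℝ → ℝ} (hη : ContDiff ℝ ∞ η) {R : ℝ} (hR : 0 < R) (hT : (R : EReal) < T)
    (hs : tsupport η ⊆ Icc (-R) R) (hR0 : η R = 0) (hR1 : deriv η R = 0) (h0 : η 0 = 1)
    (h1 : deriv η 0 = 0) :
    ε * ((∫ x, u₀ x ∂μ).re + (∫ x, u₁ x ∂μ).re) + ∫ s in (0 : ℝ)..R, (∫ x, ‖u s x‖ ^ p ∂μ) * η s
      = ∫ s in (0 : ℝ)..R, (∫ x, u s x ∂μ).re * (deriv (deriv η) s - deriv η s) := by
  have hη' : ContDiff ℝ ∞ (deriv η) := (contDiff_infty_iff_deriv.1 hη).2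
  have hη'' : ContDiff ℝ ∞ (deriv (deriv η)) := (contDiff_infty_iff_deriv.1 hη').2
  have key := h.integral_eq _ (isTestFunction_time hη hs hT) R ⟨hR.le, hT⟩ hR
  have hlap : ∀ s, (laplacianHalfPow g μ (2 * α) fun _ : G ↦ (η s : ℂ)) = 0 := fun s ↦
    laplacianHalfPow_const μ g (by positivity) _
  rw [timeDeriv_time (hη.differentiable (by simp)),
    timeDeriv_time (hη'.differentiable (by simp))] at key
  -- The conditions at R remove the boundary terms at the final time; those at 0 leave only the
  -- means of u₀ and u₁.
  simp only [hR0, hR1, h0, h1, hlap, Complex.ofReal_zero, Complex.ofReal_one, mul_zero, mul_one,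
    integral_zero] at key
  have hL : ∀ s, ∫ x, u s x *
      (((deriv (deriv η) s : ℝ) : ℂ) + (0 : Lp ℂ 2 μ) x - ((deriv η s : ℝ) : ℂ)) ∂μ
      = (∫ x, u s x ∂μ) * ((deriv (deriv η) s - deriv η s : ℝ) : ℂ) := fun s ↦ by
    rw [← integral_mul_const]
    refine integral_congr_ae ?_
    filter_upwards [Lp.coeFn_zero ℂ 2 μ] with x hx
    simp only [hx]
    simp
  have hN : ∀ s, ∫ x, ((‖u s x‖ ^ p : ℝ) : ℂ) * (η s : ℂ) ∂μ
      = (((∫ x, ‖u s x‖ ^ p ∂μ) * η s : ℝ) : ℂ) := fun s ↦ by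
    rw [← integral_mul_const, ← integral_complex_ofReal]
    simp
  simp only [hL, hN] at key
  rw [intervalIntegral.integral_ofReal] at key
  have hcont : ContinuousOn (fun s ↦ (∫ x, u s x ∂μ) * ((deriv (deriv η) s - deriv η s : ℝ) : ℂ))
      (uIcc 0 R) := by
    refine (continuous_integral_L2.comp_continuousOn (h.contDiffOn.continuousOn.mono ?_)).mul
      (Complex.continuous_ofReal.comp (hη''.continuous.sub hη'.continuous)).continuousOn
    rw [uIcc_of_le hR.le]
    exact fun s hs ↦ ⟨hs.1, (EReal.coe_le_coe_iff.2 hs.2).trans_lt hT⟩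
  have hre := Complex.reCLM.intervalIntegral_comp_comm (μ := volume)
    (hcont.intervalIntegrable (μ := volume))
  have key' := congrArg Complex.re key
  simp only [Complex.reCLM_apply, Complex.re_mul_ofReal] at hre
  rw [hre]
  simp only [Complex.add_re, Complex.sub_re, Complex.re_ofReal_mul, Complex.ofReal_re,
    Complex.zero_re] at key'
  linarith

/-- The test function estimate `ε J ≤ K^q R^(1 - q)`, with `q` the exponent conjugate to `p`. -/
theorem IsEnergySolution.data_le (h : IsEnergySolution g μ α p ε u₀ u₁ T u) (hα : 0 < α)
    {q : ℝ} (hpq : p.HolderConjugate q) {K : ℝ} (hK : 0 ≤ K)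
    {η : ℝ → ℝ} (hη : ContDiff ℝ ∞ η) {R : ℝ} (hR : 0 < R) (hT : (R : EReal) < T)
    (hpos : ∀ s, 0 ≤ η s)
    (hs : tsupport η ⊆ Icc (-R) R) (hR0 : η R = 0) (hR1 : deriv η R = 0) (h0 : η 0 = 1)
    (h1 : deriv η 0 = 0)
    (hb : ∀ s, |deriv (deriv η) s - deriv η s| ≤ K / R * η s ^ (1 / p)) :
    ε * ((∫ x, u₀ x ∂μ).re + (∫ x, u₁ x ∂μ).re) ≤ K ^ q * R ^ (1 - q) := by
  have hp := hpq.lt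
  have hη' : ContDiff ℝ ∞ (deriv η) := (contDiff_infty_iff_deriv.1 hη).2
  have hη'' : ContDiff ℝ ∞ (deriv (deriv η)) := (contDiff_infty_iff_deriv.1 hη').2
  have hid := h.mean_eq hα hη hR hT hs hR0 hR1 h0 h1
  obtain ⟨hae, hint⟩ := h.integrableOn_power hp ⟨hR.le, hT⟩
  have hcont : ContinuousOn (fun s ↦ (∫ x, u s x ∂μ).re * (deriv (deriv η) s - deriv η s))
      (uIcc 0 R) := by
    refine (Complex.continuous_re.comp_continuousOn (continuous_integral_L2.comp_continuousOn
      (h.contDiffOn.continuousOn.mono ?_))).mul (hη''.continuous.sub hη'.continuous).continuousOn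
    rw [uIcc_of_le hR.le]
    exact fun s hs ↦ ⟨hs.1, (EReal.coe_le_coe_iff.2 hs.2).trans_lt hT⟩
  have hNη : IntervalIntegrable (fun s ↦ (∫ x, ‖u s x‖ ^ p ∂μ) * η s) volume 0 R := by
    refine (IntervalIntegrable.mul_continuousOn ?_ hη.continuous.continuousOn)
    rw [intervalIntegrable_iff_integrableOn_Icc_of_le hR.le]
    exact hint
  have hle : ∫ s in (0 : ℝ)..R, (∫ x, u s x ∂μ).re * (deriv (deriv η) s - deriv η s)
      ≤ ∫ s in (0 : ℝ)..R, ((∫ x, ‖u s x‖ ^ p ∂μ) * η s + (K / R) ^ q) := by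
    refine intervalIntegral.integral_mono_ae_restrict hR.le hcont.intervalIntegrable
      (hNη.add intervalIntegrable_const) ?_
    filter_upwards [hae] with s hsI
    have hJ := norm_integral_rpow_le hp.le (integrable_of_L2 (u s)) hsI
    set F := ∫ x, u s x ∂μ
    -- The p-th power in Young's inequality restores the weight η of the nonlinear term, so that
    -- term can be absorbed.
    have hη1 : (η s ^ (1 / p)) ^ p = η s := by
      rw [← Real.rpow_mul (hpos s), one_div_mul_cancel (by linarith), Real.rpow_one]
    have hr : 0 ≤ η s ^ (1 / p) := Real.rpow_nonneg (hpos s) _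
    have hKR : 0 ≤ K / R := by positivity
    calc F.re * (deriv (deriv η) s - deriv η s)
        ≤ |F.re| * |deriv (deriv η) s - deriv η s| := by rw [← abs_mul]; exact le_abs_self _
      _ ≤ ‖F‖ * (K / R * η s ^ (1 / p)) := by
          gcongr
          · exact Complex.abs_re_le_norm _
          · exact hb s
      _ = (‖F‖ * η s ^ (1 / p)) * (K / R) := by ring
      _ ≤ (‖F‖ * η s ^ (1 / p)) ^ p / p + (K / R) ^ q / q :=
          Real.young_inequality_of_nonneg (by positivity) hKR hpq
      _ ≤ (‖F‖ * η s ^ (1 / p)) ^ p + (K / R) ^ q :=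
          add_le_add (div_le_self (by positivity) hp.le)
            (div_le_self (by positivity) hpq.symm.lt.le)
      _ = ‖F‖ ^ p * η s + (K / R) ^ q := by rw [Real.mul_rpow (norm_nonneg _) hr, hη1]
      _ ≤ _ := by
          have := mul_le_mul_of_nonneg_right hJ (hpos s)
          linarith
  rw [intervalIntegral.integral_add hNη intervalIntegrable_const,
    intervalIntegral.integral_const, smul_eq_mul, sub_zero] at hle
  have : R * (K / R) ^ q = K ^ q * R ^ (1 - q) := by
    rw [Real.div_rpow hK hR.le, Real.rpow_sub hR, Real.rpow_one]
    ring
  linarith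

end Energy

/-! ### The lifespan bound -/

/-- Every time of existence is at most `C ε^(1 - p)`. -/
theorem exists_existence_time_bound {n : ℕ} {G : Type*} [TopologicalSpace G] [CompactSpace G]
    [ChartedSpace (EuclideanSpace ℝ (Fin n)) G] [Group G] [IsTopologicalGroup G]
    [MeasurableSpace G] [BorelSpace G] (μ : Measure G) [μ.IsHaarMeasure] [IsProbabilityMeasure μ]
    (g : BiinvariantMetric n G) {p : ℝ} (hp : 1 < p) {u₀ u₁ : Lp ℂ 2 μ}
    (hJ : 0 < (∫ x, u₀ x ∂μ).re + (∫ x, u₁ x ∂μ).re) :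
    ∃ ε₀ : ℝ, 0 < ε₀ ∧ ∃ C : ℝ, 0 < C ∧ ∀ α : ℝ, 0 < α → ∀ ε : ℝ, 0 < ε → ε ≤ ε₀ →
      ∀ (T : EReal) (u : ℝ → Lp ℂ 2 μ), IsEnergySolution g μ α p ε u₀ u₁ T u →
        T ≤ ((C * ε ^ (1 - p) : ℝ) : EReal) := by
  obtain ⟨K, hK, hcut⟩ := exists_cutoff hp
  set J := (∫ x, u₀ x ∂μ).re + (∫ x, u₁ x ∂μ).re
  obtain ⟨q, hpq⟩ : ∃ q, p.HolderConjugate q := ⟨_, .conjExponent hp⟩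
  have hM : 0 < K ^ q := by positivity
  -- The test time is R = (ε₀/ε)^(p-1): ε ≤ ε₀ ensures R ≥ 1, and the factor 2 turns the estimate
  -- into εJ ≤ εJ/2, a contradiction.
  set ε₀ : ℝ := 2 * K ^ q / J
  have hε₀ : 0 < ε₀ := by positivity
  refine ⟨ε₀, hε₀, ε₀ ^ (p - 1), by positivity, fun α hα ε hε hle T u h ↦ ?_⟩
  have hR : ε₀ ^ (p - 1) * ε ^ (1 - p) = (ε₀ / ε) ^ (p - 1) := by
    rw [Real.div_rpow hε₀.le hε.le, div_eq_mul_inv, ← Real.rpow_neg hε.le, neg_sub]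
  rw [hR]
  by_contra! hT
  have hR1 : 1 ≤ (ε₀ / ε) ^ (p - 1) :=
    Real.one_le_rpow ((one_le_div hε).2 hle) (by linarith)
  obtain ⟨η, hη, hpos, hs, hR0, hR1', h0, h1, hb⟩ := hcut _ hR1
  have := h.data_le hα hpq hK.le hη (by linarith) hT hpos hs hR0 hR1' h0 h1 hb
  have hexp : (p - 1) * (1 - q) = -1 := by
    linarith [hpq.mul_eq_add]
  rw [← Real.rpow_mul (by positivity), hexp, Real.rpow_neg_one, inv_div] at this
  have e : K ^ q * (ε / ε₀) = ε * J / 2 := by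
    simp only [ε₀]; field_simp
  have : 0 < ε * J := by positivity
  linarith

end FracDampedWave

open FracDampedWave in
theorem theorem1p3 {n : ℕ} {G : Type*} [TopologicalSpace G] [T2Space G] [CompactSpace G]
    [ChartedSpace (EuclideanSpace ℝ (Fin n)) G] [Group G] [LieGroup (𝓡 n) ∞ G]
    [MeasurableSpace G] [BorelSpace G]
    (μ : Measure G) [μ.IsHaarMeasure] [IsProbabilityMeasure μ]
    (g : BiinvariantMetric n G) (p : ℝ) (hp : 1 < p) (u₀ u₁ : Lp ℂ 2 μ)
    (hu₀ : ∀ᵐ x ∂μ, (u₀ x).im = 0 ∧ 0 ≤ (u₀ x).re)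
    (hu₁ : ∀ᵐ x ∂μ, (u₁ x).im = 0 ∧ 0 ≤ (u₁ x).re)
    (hne : u₀ ≠ 0 ∨ u₁ ≠ 0) :
    ∃ ε₀ : ℝ, 0 < ε₀ ∧ ∃ C : ℝ, 0 < C ∧
      ∀ α : ℝ, 0 < α → α < 1 → MemSobolev g μ α u₀ →
        ∀ ε : ℝ, 0 < ε → ε ≤ ε₀ →
          ∀ (T : EReal) (u : ℝ → Lp ℂ 2 μ), IsEnergySolution g μ α p ε u₀ u₁ T u →
            lifespan g μ α p ε u₀ u₁ T u < ⊤ ∧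
            lifespan g μ α p ε u₀ u₁ T u ≤ ((C * ε ^ (1 - p) : ℝ) : EReal) := by
  have : IsTopologicalGroup G := topologicalGroup_of_lieGroup (𝓡 n) ∞
  have hnn : ∀ f : Lp ℂ 2 μ, (∀ᵐ x ∂μ, (f x).im = 0 ∧ 0 ≤ (f x).re) →
      0 ≤ (∫ x, f x ∂μ).re := fun f hf ↦ by
    by_cases h : f = 0
    · rw [h, integral_congr_ae (Lp.coeFn_zero ℂ 2 μ)]; simp
    · exact (integral_re_pos_of_ne_zero hf h).le
  have hJ : 0 < (∫ x, u₀ x ∂μ).re + (∫ x, u₁ x ∂μ).re := by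
    rcases hne with h | h
    · exact add_pos_of_pos_of_nonneg (integral_re_pos_of_ne_zero hu₀ h) (hnn _ hu₁)
    · exact add_pos_of_nonneg_of_pos (hnn _ hu₀) (integral_re_pos_of_ne_zero hu₁ h)
  obtain ⟨ε₀, hε₀, C, hC, hbound⟩ := exists_existence_time_bound μ g hp hJ
  refine ⟨ε₀, hε₀, C, hC, fun α hα _ _ ε hε hle T u _ ↦ ?_⟩
  have hlife : lifespan g μ α p ε u₀ u₁ T u ≤ ((C * ε ^ (1 - p) : ℝ) : EReal) :=
    -- Each extension is itself an energy solution with the same data, so the bound applies to every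
    -- competing T'.
    sSup_le fun T' ⟨_, v, hv, _⟩ ↦ hbound α hα ε hε hle T' v hv
  exact ⟨hlife.trans_lt (EReal.coe_lt_top _), hlife⟩
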